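/- **Setting.** There are $S$ time stamps and $M$ base stations. Each user has a trajectory, i.e. one base station for every time stamp. A finite population of users generates the aggregated mobility dataset $D=\{D_i\}_{i=1}^S$, where $D_i=(u^i_1,\dots,u^i_M)$ and $u^i_m$ is the number of users at station $m$ at time stamp $i$. Two datasets are *neighboring* if they are generated by two populations, one of which is obtained from the other by excluding one user's trajectory. A randomized mechanism $\mathcal M$ is *$\epsilon$-differentially private* if $\Pr[\mathcal M(D)\in O]\le e^{\epsilon}\Pr[\mathcal M(D')\in O]$ for all neighboring $D,D'$ and all measurable sets $O$ of outputs. $\mathrm{Lap}(b)$ is the Laplace distribution with density $\frac1{2b}e^{-|x|/b}$; perturbing a histogram with $\mathrm{Lap}(b)$ means adding i.i.d. $\mathrm{Lap}(b)$ noise to each of its coordinates; $\mathrm{Dist}$ is the $L_1$ distance. All noise variables are independent. **Threshold perturbation mechanism.** Input: a dataset $D$, a budget $\epsilon>0$, a fixed ratio $\alpha\in(0,1)$, a fixed threshold $T\in\mathbb R$, a distance sensitivity parameter $\Delta_D$, an integer cutoff point $c\ge1$. Output: $\widetilde D=\{\widetilde D_i\}_{i=1}^S$ with real-valued histograms $\widetilde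 D_i$. 1. Set $\epsilon_1=\alpha\epsilon$ and $\epsilon_2=(1-\alpha)\epsilon$. Perturb $D_1$ with $\mathrm{Lap}(c\Delta_D/\epsilon_2)$ to get $\widetilde D_1$. Set $\widetilde T_1=T+\mathrm{Lap}(c\Delta_D/\epsilon_1)$ and $cnt=1$. 2. For $i=2,\dots,S$: * if $cnt\ge c$, set $\widetilde D_i=\widetilde D_{i-1}$; * otherwise, if $i=S$, perturb $D_S$ with $\mathrm{Lap}(\Delta_D/\epsilon_l)$ to get $\widetilde D_S$, where $\epsilon_l=\epsilon-cnt\,(\epsilon_1/c+\epsilon_2/c)$ is the budget left; * otherwise, set $\widetilde d_i=\mathrm{Dist}(\widetilde D_{i-1},D_i)+\mathrm{Lap}(2c\Delta_D/\epsilon_1)$. If $\widetilde d_i\ge\widetilde T_{cnt}$, perturb $D_i$ with $\mathrm{Lap}(c\Delta_D/\epsilon_2)$ to get $\widetilde D_i$, increase $cnt$ by $1$, and set $\widetilde T_{cnt}=T+\mathrm{Lap}(c\Delta_D/\epsilon_1)$ with fresh noise; if $\widetilde d_i<\widetilde T_{cnt}$, set $\widetilde D_i=\widetilde D_{i-1}$.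 **Theorem.** For all $S$, $M$, $\epsilon>0$, $\alpha\in(0,1)$, $T\in\mathbb R$, all integers $c\ge1$, and for $\Delta_D=2$ (more generally, for every $\Delta_D\ge2$), the threshold perturbation mechanism is a well-defined randomized mechanism (its output law is a probability measure for every input) and it preserves $\epsilon$-differential privacy. -/

import Mathlib

open MeasureTheory

/-- A trajectory of one user: the base station (out of `M`) at which the user is located at each of
the `S` time stamps. -/
abbrev Trajectory (S M : ℕ) : Type := Fin S → Fin M

/-- An aggregated mobility dataset: for each time stamp, the histogram of the numbers of users at
the base stations. -/
abbrev AggregatedDataset (S M : ℕ) : Type := Fin S → Fin M → ℕ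

/-- A released (noisy) dataset: one real-valued histogram per time stamp. -/
abbrev NoisyDataset (S M : ℕ) : Type := Fin S → Fin M → ℝ

/-- The aggregated dataset of a finite population of users, given by their trajectories. -/
def aggregate {S M : ℕ} (U : Multiset (Trajectory S M)) : AggregatedDataset S M :=
  fun i m => U.countP (fun l => l i = m)

/-- Two aggregated datasets are neighboring if they are generated by populations one of which
arises from the other by excluding one user's trajectory. -/
def Neighboring {S M : ℕ} (D D' : AggregatedDataset S M) : Prop :=
  ∃ (U : Multiset (Trajectory S M)) (l : Trajectory S M),
    (D = aggregate (l ::ₘ U) ∧ D' = aggregate U) ∨ (D = aggregate U ∧ D' = aggregate (l ::ₘ U))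

/-- `ε`-differential privacy of a randomized mechanism, given by the law of its output on each
input, with respect to a neighboring relation. That every output law is a probability measure is
part of the definition. -/
def IsDifferentiallyPrivate {𝒟 𝒪 : Type*} [MeasurableSpace 𝒪] (neighboring : 𝒟 → 𝒟 → Prop)
    (mech : 𝒟 → Measure 𝒪) (ε : ℝ) : Prop :=
  (∀ D, IsProbabilityMeasure (mech D)) ∧
    ∀ D D', neighboring D D' → ∀ O : Set 𝒪, MeasurableSet O →
      mech D O ≤ ENNReal.ofReal (Real.exp ε) * mech D' O

/-- The (centered) Laplace distribution `Lap(b)`, with density `exp (-|x| / b) / (2 b)`. -/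
noncomputable def laplace (b : ℝ) : Measure ℝ :=
  volume.withDensity (fun x => ENNReal.ofReal (1 / (2 * b) * Real.exp (-(|x| / b))))

/-- The law of the histogram `h` perturbed by i.i.d. `Lap(b)` noise in every coordinate. -/
noncomputable def perturb {M : ℕ} (b : ℝ) (h : Fin M → ℕ) : Measure (Fin M → ℝ) :=
  (Measure.pi (fun _ : Fin M => laplace b)).map (fun noise m => (h m : ℝ) + noise m)

/-- The `L₁` distance between a released histogram and an original one. -/
noncomputable def histDist {M : ℕ} (x : Fin M → ℝ) (h : Fin M → ℕ) : ℝ :=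
  ∑ m, |x m - (h m : ℝ)|

/-- The privacy budget left when `cnt` noisy thresholds (each charged `ε₁ / c`) and `cnt` newly
perturbed histograms (each charged `ε₂ / c`) have been used. -/
noncomputable def leftBudget (ε₁ ε₂ : ℝ) (c cnt : ℕ) : ℝ :=
  (ε₁ + ε₂) - (cnt : ℝ) * (ε₁ / c + ε₂ / c)

/-- The state of the threshold perturbation mechanism after a time stamp: the histogram released
at that time stamp, the counter `cnt`, and the current noisy threshold. -/
abbrev ThresholdState (M : ℕ) : Type := (Fin M → ℝ) × ℕ × ℝ

/-- One pass through the body of the loop, at a time stamp with original histogram `h`; `last` says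
whether it is the final time stamp `S`. The value is the law of the new state. -/
noncomputable def thresholdStep {M : ℕ} (ε₁ ε₂ T Δ : ℝ) (c : ℕ) (last : Bool) (h : Fin M → ℕ)
    (s : ThresholdState M) : Measure (ThresholdState M) :=
  let prev := s.1
  let cnt := s.2.1
  let thr := s.2.2
  if c ≤ cnt then
    Measure.dirac (prev, cnt, thr)
  else if last then
    (perturb (Δ / leftBudget ε₁ ε₂ c cnt) h).map (fun x => (x, cnt, thr))
  else
    (laplace (2 * c * Δ / ε₁)).bind fun ν =>
      if thr ≤ histDist prev h + ν then
        (perturb (c * Δ / ε₂) h).bind fun x =>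
          (laplace (c * Δ / ε₁)).map fun ρ => (x, cnt + 1, T + ρ)
      else
        Measure.dirac (prev, cnt, thr)

/-- The loop over the remaining `n` time stamps (the last of which is time stamp `S`), started in
the state `s`. The value is the law of the sequence of the histograms released in the loop. -/
noncomputable def thresholdLoop {M : ℕ} (ε₁ ε₂ T Δ : ℝ) (c : ℕ) :
    (n : ℕ) → AggregatedDataset n M → ThresholdState M → Measure (NoisyDataset n M)
  | 0, _, _ => Measure.dirac Fin.elim0
  | n + 1, D, s =>
      (thresholdStep ε₁ ε₂ T Δ c (decide (n = 0)) (D 0) s).bind fun s' =>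
        (thresholdLoop ε₁ ε₂ T Δ c n (fun i => D i.succ) s').map
          fun out => (Fin.cons s'.1 out : NoisyDataset (n + 1) M)

/-- The threshold perturbation mechanism with total budget `ε`, split into `ε₁ = α ε` and
`ε₂ = (1 - α) ε`, threshold `T`, distance sensitivity `Δ` and cutoff point `c`: the law of the
released dataset on the input `D`. -/
noncomputable def thresholdPerturbation {M : ℕ} (ε α T Δ : ℝ) (c : ℕ) :
    (S : ℕ) → AggregatedDataset S M → Measure (NoisyDataset S M)
  | 0, _ => Measure.dirac Fin.elim0
  | n + 1, D =>
      let ε₁ := α * ε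
      let ε₂ := (1 - α) * ε
      (perturb (c * Δ / ε₂) (D 0)).bind fun x =>
        (laplace (c * Δ / ε₁)).bind fun ρ =>
          (thresholdLoop ε₁ ε₂ T Δ c n (fun i => D i.succ) (x, 1, T + ρ)).map
            fun out => (Fin.cons x out : NoisyDataset (n + 1) M)

/-!
The mechanism is a chain of sparse vector runs. The loss is tracked as domination of output laws,
`ExpLE κ μ ν`, i.e. `μ ≤ exp κ • ν`, whose exponents add up along `Measure.bind` (`ExpLE.bind`) and
over products (`ExpLE.pi`). Since one user stands at one base station at each time stamp,
neighboring datasets have histograms at `L₁` distance at most one (`Neighboring.sum_abs_sub_le`),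
and the distances to a fixed released histogram differ by at most one (`histDist_le`).

The heart is `thresholdLoop_expLE`: the loop on `D` with threshold `t` is compared with the loop on
`D'` with threshold `t + 1`. A test that stays below `t` on `D` stays below `t + 1` on `D'` with the
same noise, so it costs nothing, however many of them there are. A test that exceeds `t` on `D`
exceeds `t + 1` on `D'` once its noise is shifted by `2`, which costs `2 / (2 c Δ / ε₁)`. It triggers
the release of a histogram, at cost `1 / (c Δ / ε₂)` by the Laplace mechanism (`perturb_expLE`), and
the draw of a new threshold, whose shift by `1` costs `1 / (c Δ / ε₁)` (`laplace_bind_shift`). The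
sum `phaseLoss` of these is `(2 ε₁ + ε₂) / (c Δ)`. Spending the budget left on the last histogram
costs no more than the phases that have not taken place (`last_loss_le`). The initial release and
threshold count as one phase, so the whole loss is at most `c` times `phaseLoss`, which is
`(2 ε₁ + ε₂) / Δ` and hence at most `ε₁ + ε₂ = ε` for `Δ ≥ 2`.

As `Measure.bind` has a junk value off measurable families, the laws of the steps and of the loop
are shown to depend measurably on the state (`measurable_thresholdStep`, `thresholdLoop_isMarkov`).
-/

/-! ### Domination of measures up to a factor `exp κ` -/

/-- `μ` is dominated by `exp κ • ν` on measurable sets. This is one direction of the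
indistinguishability demanded by `κ`-differential privacy. -/
def ExpLE {α : Type*} [MeasurableSpace α] (κ : ℝ) (μ ν : Measure α) : Prop :=
  ∀ O, MeasurableSet O → μ O ≤ ENNReal.ofReal (Real.exp κ) * ν O

namespace ExpLE

variable {α β : Type*} [MeasurableSpace α] [MeasurableSpace β] {κ κ' : ℝ}

theorem le_smul {μ ν : Measure α} (h : ExpLE κ μ ν) :
    μ ≤ ENNReal.ofReal (Real.exp κ) • ν :=
  Measure.le_iff.2 h

theorem of_eq {μ ν : Measure α} (h : μ = ν) : ExpLE 0 μ ν := by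
  subst h
  intro O _
  simp

theorem mono {μ ν : Measure α} (h : ExpLE κ μ ν) (hκ : κ ≤ κ') : ExpLE κ' μ ν := by
  intro O hO
  refine (h O hO).trans ?_
  gcongr

theorem map {μ ν : Measure α} (h : ExpLE κ μ ν) {f : α → β} (hf : Measurable f) :
    ExpLE κ (μ.map f) (ν.map f) := by
  intro O hO
  rw [Measure.map_apply hf hO, Measure.map_apply hf hO]
  exact h _ (hf hO)

/-- Sequential composition: the losses of the two stages add up. -/
theorem bind {μ ν : Measure α} (h : ExpLE κ μ ν) {f g : α → Measure β} (hf : Measurable f)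
    (hg : Measurable g) (hfg : ∀ a, ExpLE κ' (f a) (g a)) :
    ExpLE (κ + κ') (μ.bind f) (ν.bind g) := by
  intro O hO
  rw [Measure.bind_apply hO hf.aemeasurable, Measure.bind_apply hO hg.aemeasurable,
    Real.exp_add, ENNReal.ofReal_mul (Real.exp_nonneg _), mul_assoc]
  have hgO : Measurable fun a => g a O := (Measure.measurable_coe hO).comp hg
  calc ∫⁻ a, f a O ∂μ
      ≤ ∫⁻ a, ENNReal.ofReal (Real.exp κ') * g a O ∂μ := lintegral_mono fun a => hfg a O hO
    _ ≤ ∫⁻ a, ENNReal.ofReal (Real.exp κ') * g a O ∂(ENNReal.ofReal (Real.exp κ) • ν) :=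
        lintegral_mono' h.le_smul le_rfl
    _ = _ := by rw [lintegral_smul_measure, lintegral_const_mul _ hgO, smul_eq_mul]

/-- Parallel composition: the loss of a product of measures is the sum of the losses. -/
theorem pi {ι : Type*} [Fintype ι] {κ : ι → ℝ} {μ ν : ι → Measure α}
    [∀ i, IsFiniteMeasure (μ i)] [∀ i, IsFiniteMeasure (ν i)] (h : ∀ i, ExpLE (κ i) (μ i) (ν i)) :
    ExpLE (∑ i, κ i) (Measure.pi μ) (Measure.pi ν) := by
  let C : ι → NNReal := fun i => (Real.exp (κ i)).toNNReal
  have hle : Measure.pi μ ≤ Measure.pi (fun i => C i • ν i) := by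
    refine Measure.le_iff.2 fun O hO => ?_
    have hout : (Measure.pi μ).toOuterMeasure ≤
        OuterMeasure.pi fun i => (C i • ν i).toOuterMeasure := by
      refine OuterMeasure.le_pi.2 fun s _ => ?_
      change Measure.pi μ _ ≤ _
      rw [Measure.pi_pi]
      exact Finset.prod_le_prod' fun i _ => (h i).le_smul (s i)
    rw [Measure.pi_def (fun i => C i • ν i), toMeasure_apply _ _ hO]
    exact hout O
  have hsmul : Measure.pi (fun i => C i • ν i) = (∏ i, C i) • Measure.pi ν := by
    refine Measure.pi_eq fun s _ => ?_
    rw [Measure.smul_apply, Measure.pi_pi, ENNReal.smul_def, smul_eq_mul,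
      ENNReal.ofNNReal_finsetProd, ← Finset.prod_mul_distrib]
    rfl
  intro O _
  refine (hle O).trans ?_
  rw [hsmul, Real.exp_sum, ENNReal.ofReal_prod_of_nonneg fun i _ => Real.exp_nonneg _]
  simp [C, ENNReal.smul_def, ENNReal.ofReal]

end ExpLE

/-! ### Laplace noise -/

theorem isProbabilityMeasure_laplace {b : ℝ} (hb : 0 < b) :
    IsProbabilityMeasure (laplace b) := by
  constructor
  have hneg : -1 / b < 0 := div_neg_of_neg_of_pos (by norm_num) hb
  have hexp : (∫ x in Set.Ioi (0 : ℝ), Real.exp (-(x / b))) = b := by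
    have h := integral_exp_mul_Ioi hneg 0
    rw [show (fun x : ℝ => Real.exp (-(x / b))) = fun x => Real.exp (-1 / b * x) by
      funext x; congr 1; ring, h]
    simp
  have hint : ∫ x, Real.exp (-(|x| / b)) = 2 * b := by
    rw [integral_comp_abs (f := fun x => Real.exp (-(x / b))), hexp]
  -- a non-integrable density would have integral zero
  have hi : Integrable fun x : ℝ => Real.exp (-(|x| / b)) :=
    Integrable.of_integral_ne_zero (by rw [hint]; positivity)
  rw [laplace, withDensity_apply _ MeasurableSet.univ, Measure.restrict_univ,
    ← ofReal_integral_eq_lintegral_ofReal (hi.const_mul _)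
      (Filter.Eventually.of_forall fun x => by positivity), integral_const_mul, hint]
  rw [one_div_mul_cancel (by positivity), ENNReal.ofReal_one]

/-- Translating Laplace noise of scale `b` by `t` costs `|t| / b`. -/
theorem laplace_map_add {b : ℝ} (hb : 0 < b) (s t : ℝ) :
    ExpLE (|s - t| / b) ((laplace b).map (fun x => s + x)) ((laplace b).map (fun x => t + x)) := by
  have key : ∀ (u : ℝ) (O : Set ℝ), MeasurableSet O → (laplace b).map (fun x => u + x) O
      = ∫⁻ x in O, ENNReal.ofReal (1 / (2 * b) * Real.exp (-(|x - u| / b))) := by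
    intro u O hO
    have hO' : MeasurableSet ((fun x => u + x) ⁻¹' O) := (measurable_const_add u) hO
    rw [Measure.map_apply (measurable_const_add u) hO, laplace, withDensity_apply _ hO',
      ← (measurePreserving_add_left volume u).setLIntegral_comp_preimage hO (by fun_prop)]
    simp
  intro O hO
  rw [key s O hO, key t O hO, ← lintegral_const_mul _ (by fun_prop)]
  refine lintegral_mono fun x => ?_
  rw [← ENNReal.ofReal_mul (Real.exp_nonneg _)]
  refine ENNReal.ofReal_le_ofReal ?_
  rw [mul_left_comm, ← Real.exp_add]
  have h : |x - t| ≤ |x - s| + |s - t| := abs_sub_le _ _ _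
  have h' : |x - t| / b ≤ |x - s| / b + |s - t| / b := by
    rw [← add_div]
    gcongr
  gcongr
  linarith

/-- The loss incurred when a family of measures driven by Laplace noise is compared with a family
evaluated at translated noise. -/
theorem laplace_bind_shift {β : Type*} [MeasurableSpace β] {b κ : ℝ} (hb : 0 < b) (t : ℝ)
    {f g : ℝ → Measure β} (hf : Measurable f) (hg : Measurable g)
    (hfg : ∀ x, ExpLE κ (f x) (g (x + t))) :
    ExpLE (|t| / b + κ) ((laplace b).bind f) ((laplace b).bind g) := by
  have h := laplace_map_add hb t 0
  have hid : (laplace b).map (fun x => 0 + x) = laplace b := by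
    simp only [zero_add]; exact Measure.map_id
  rw [hid, sub_zero] at h
  have hbind : (laplace b).bind f = ((laplace b).map (fun x => t + x)).bind fun x => f (x - t) := by
    rw [Measure.bind, Measure.bind, Measure.map_map (by fun_prop) (by fun_prop)]
    congr 2
    funext x
    simp
  rw [hbind]
  refine h.bind (by fun_prop) hg fun x => ?_
  simpa using hfg (x - t)

/-- The loss in the probability of an event which is pushed into another one by a translation. -/
theorem laplace_apply_shift {b : ℝ} (hb : 0 < b) (t : ℝ) {p q : ℝ → Prop}
    (hq : MeasurableSet {x | q x})
    (hpq : ∀ x, p x → q (x + t)) :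
    laplace b {x | p x} ≤ ENNReal.ofReal (Real.exp (|t| / b)) * laplace b {x | q x} := by
  have h := laplace_map_add hb t 0 _ hq
  rw [Measure.map_apply (by fun_prop) hq, Measure.map_apply (by fun_prop) hq, sub_zero] at h
  simp only [zero_add, Set.preimage_id'] at h
  refine (measure_mono fun x hx => ?_).trans h
  rw [Set.mem_preimage, add_comm]
  exact hpq x hx

theorem isProbabilityMeasure_perturb {M : ℕ} {b : ℝ} (hb : 0 < b) (h : Fin M → ℕ) :
    IsProbabilityMeasure (perturb b h) := by
  have := isProbabilityMeasure_laplace hb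
  exact Measure.isProbabilityMeasure_map
    (measurable_pi_lambda _ fun m => (measurable_pi_apply m).const_add _).aemeasurable

/-- The Laplace mechanism: histograms at `L₁` distance at most one are perturbed at loss
`1 / b`. -/
theorem perturb_expLE {M : ℕ} {b : ℝ} (hb : 0 < b) {h h' : Fin M → ℕ}
    (hh : ∑ m, |(h m : ℝ) - h' m| ≤ 1) : ExpLE (1 / b) (perturb b h) (perturb b h') := by
  have := isProbabilityMeasure_laplace hb
  have hp : ∀ u : ℝ, IsProbabilityMeasure ((laplace b).map (fun x => u + x)) := fun u =>
    Measure.isProbabilityMeasure_map (by fun_prop)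
  have hpi : ∀ k : Fin M → ℕ,
      perturb b k = Measure.pi fun m => (laplace b).map (fun x => (k m : ℝ) + x) := fun k =>
    Measure.pi_map_pi fun m => by fun_prop
  rw [hpi, hpi]
  refine (ExpLE.pi fun m => laplace_map_add hb (h m : ℝ) (h' m)).mono ?_
  rw [← Finset.sum_div]
  gcongr

theorem histDist_le {M : ℕ} (x : Fin M → ℝ) {h h' : Fin M → ℕ}
    (hh : ∑ m, |(h m : ℝ) - h' m| ≤ 1) : histDist x h ≤ histDist x h' + 1 := by
  unfold histDist
  calc ∑ m, |x m - (h m : ℝ)| ≤ ∑ m, (|x m - (h' m : ℝ)| + |(h m : ℝ) - h' m|) := by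
        refine Finset.sum_le_sum fun m _ => ?_
        rw [abs_sub_comm (h m : ℝ)]
        exact abs_sub_le _ _ _
    _ ≤ _ := by rw [Finset.sum_add_distrib]; gcongr

/-! ### Measurability in parameters -/

section Parametric

variable {α β γ : Type*} [MeasurableSpace α] [MeasurableSpace β] [MeasurableSpace γ]

theorem measurable_bind_param {κ : α → Measure β} (hκ : Measurable κ)
    [∀ a, IsProbabilityMeasure (κ a)] {f : α → β → Measure γ}
    (hf : Measurable (Function.uncurry f)) : Measurable fun a => (κ a).bind (f a) := by
  let K : ProbabilityTheory.Kernel α β := ⟨κ, hκ⟩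
  have : ProbabilityTheory.IsMarkovKernel K :=
    ⟨fun a => inferInstanceAs (IsProbabilityMeasure (κ a))⟩
  refine Measure.measurable_of_measurable_coe _ fun O hO => ?_
  have h : ∀ a, (κ a).bind (f a) O = ∫⁻ b, f a b O ∂(K a) := fun a =>
    Measure.bind_apply hO (hf.comp measurable_prodMk_left).aemeasurable
  simp_rw [h]
  exact Measurable.lintegral_kernel_prod_right ((Measure.measurable_coe hO).comp hf)

theorem measurable_map_param {κ : α → Measure β} (hκ : Measurable κ)
    [∀ a, IsProbabilityMeasure (κ a)] {f : α → β → γ}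
    (hf : Measurable (Function.uncurry f)) : Measurable fun a => (κ a).map (f a) := by
  have h : ∀ a, (κ a).map (f a) = (κ a).bind fun b => Measure.dirac (f a b) := fun a =>
    (Measure.bind_dirac_eq_map _ (hf.comp measurable_prodMk_left)).symm
  simp_rw [h]
  exact measurable_bind_param hκ (Measure.measurable_dirac.comp hf)

theorem isProbabilityMeasure_bind_of_measurable {μ : Measure α} [IsProbabilityMeasure μ]
    {f : α → Measure β} (hf : Measurable f) (h : ∀ a, IsProbabilityMeasure (f a)) :
    IsProbabilityMeasure (μ.bind f) :=
  isProbabilityMeasure_bind hf.aemeasurable (Filter.Eventually.of_forall h)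

theorem bind_map_eq_bind {μ : Measure α} {f : α → β} (hf : Measurable f) {g : β → Measure γ}
    (hg : Measurable g) : (μ.map f).bind g = μ.bind fun a => g (f a) := by
  rw [Measure.bind, Measure.bind, Measure.map_map hg hf]
  rfl

theorem bind_ite_apply (μ : Measure α) {p : α → Prop} [DecidablePred p]
    (hp : MeasurableSet {a | p a}) (ν₁ ν₂ : Measure β) {O : Set β} (hO : MeasurableSet O) :
    μ.bind (fun a => if p a then ν₁ else ν₂) O = μ {a | p a} * ν₁ O + μ {a | ¬ p a} * ν₂ O := by
  rw [Measure.bind_apply hO (Measurable.ite hp measurable_const measurable_const).aemeasurable,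
    ← lintegral_add_compl _ hp,
    setLIntegral_congr_fun (g := fun _ => ν₁ O) hp fun a (ha : p a) => by simp [ha],
    setLIntegral_congr_fun (g := fun _ => ν₂ O) hp.compl fun a (ha : ¬ p a) => by simp [ha]]
  simp [mul_comm, Set.compl_ofPred]

end Parametric

/-! ### The mechanism as a composition of Markov kernels -/

section Mechanism

variable {M : ℕ} {ε₁ ε₂ T Δ : ℝ} {c : ℕ}

theorem leftBudget_eq {cnt : ℕ} (hc : 0 < c) :
    leftBudget ε₁ ε₂ c cnt = ((c : ℝ) - cnt) * ((ε₁ + ε₂) / c) := by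
  have : (c : ℝ) ≠ 0 := by positivity
  unfold leftBudget
  field_simp

theorem leftBudget_pos (h₁ : 0 < ε₁) (h₂ : 0 < ε₂) {cnt : ℕ} (hcnt : cnt < c) :
    0 < leftBudget ε₁ ε₂ c cnt := by
  have hc : 0 < c := by omega
  have : (0 : ℝ) < (c : ℝ) - cnt := sub_pos.2 (by exact_mod_cast hcnt)
  rw [leftBudget_eq hc]
  positivity

theorem measurable_histDist (h : Fin M → ℕ) : Measurable fun x : Fin M → ℝ => histDist x h := by
  unfold histDist
  fun_prop

theorem measurable_cons (n : ℕ) : Measurable (Function.uncurry fun (x : Fin M → ℝ)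
    (out : NoisyDataset n M) => (Fin.cons x out : NoisyDataset (n + 1) M)) := by
  refine measurable_pi_lambda _ fun i => ?_
  refine Fin.cases ?_ (fun j => ?_) i
  · simpa [Function.uncurry_def] using measurable_fst
  · simpa [Function.uncurry_def, Function.comp_def] using
      (measurable_pi_apply j).comp (measurable_snd (α := Fin M → ℝ) (β := NoisyDataset n M))

theorem measurable_cons_right {n : ℕ} (x : Fin M → ℝ) :
    Measurable fun out : NoisyDataset n M => (Fin.cons x out : NoisyDataset (n + 1) M) :=
  (measurable_cons n).comp measurable_prodMk_left

theorem measurable_drawThreshold {cnt : ℕ} {b' : ℝ} (hb' : 0 < b') :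
    Measurable (fun x : Fin M → ℝ => (laplace b').map fun ρ =>
      ((x, cnt, T + ρ) : ThresholdState M)) := by
  have := isProbabilityMeasure_laplace hb'
  exact measurable_map_param (κ := fun _ => laplace b') measurable_const (by
    unfold Function.uncurry; fun_prop)

theorem measurable_thresholdStep (h₁ : 0 < ε₁) (h₂ : 0 < ε₂) (hΔ : 0 < Δ) (hc : 0 < c)
    (last : Bool) (h : Fin M → ℕ) : Measurable (thresholdStep ε₁ ε₂ T Δ c last h) := by
  have hc' : (0 : ℝ) < c := by exact_mod_cast hc
  have hl := isProbabilityMeasure_laplace (b := 2 * c * Δ / ε₁) (by positivity)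
  -- the counter is discrete, so it may be fixed
  suffices H : Measurable fun p : ((Fin M → ℝ) × ℝ) × ℕ =>
      thresholdStep ε₁ ε₂ T Δ c last h (p.1.1, p.2, p.1.2) from
    H.comp (g := thresholdStep ε₁ ε₂ T Δ c last h ∘ fun p : ((Fin M → ℝ) × ℝ) × ℕ =>
      (p.1.1, p.2, p.1.2)) (f := fun s : ThresholdState M => ((s.1, s.2.2), s.2.1)) (by fun_prop)
  refine measurable_from_prod_countable_left fun cnt => ?_
  by_cases hcnt : c ≤ cnt
  · simp only [thresholdStep, hcnt, if_true]
    exact Measure.measurable_dirac.comp (by fun_prop)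
  cases last
  · simp only [thresholdStep, hcnt, if_false, Bool.false_eq_true]
    refine measurable_bind_param (κ := fun _ => laplace (2 * c * Δ / ε₁)) measurable_const ?_
    refine Measurable.ite ?_ measurable_const (Measure.measurable_dirac.comp (by fun_prop))
    have := measurable_histDist h
    exact measurableSet_le (by fun_prop) (by fun_prop)
  · simp only [thresholdStep, hcnt, if_false, if_true]
    have := isProbabilityMeasure_perturb
      (div_pos hΔ (leftBudget_pos h₁ h₂ (not_le.1 hcnt))) h
    exact measurable_map_param (κ := fun _ => perturb (Δ / leftBudget ε₁ ε₂ c cnt) h)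
      measurable_const (by unfold Function.uncurry; fun_prop)

theorem isProbabilityMeasure_thresholdStep (h₁ : 0 < ε₁) (h₂ : 0 < ε₂) (hΔ : 0 < Δ) (hc : 0 < c)
    (last : Bool) (h : Fin M → ℕ) (s : ThresholdState M) :
    IsProbabilityMeasure (thresholdStep ε₁ ε₂ T Δ c last h s) := by
  have hc' : (0 : ℝ) < c := by exact_mod_cast hc
  have hl₁ := isProbabilityMeasure_laplace (b := 2 * c * Δ / ε₁) (by positivity)
  have hl₂ := isProbabilityMeasure_laplace (b := c * Δ / ε₁) (by positivity)
  have hp := isProbabilityMeasure_perturb (b := c * Δ / ε₂) (by positivity) h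
  obtain ⟨x, cnt, thr⟩ := s
  by_cases hcnt : c ≤ cnt
  · simp only [thresholdStep, hcnt, if_true]
    infer_instance
  cases last
  · simp only [thresholdStep, hcnt, if_false, Bool.false_eq_true]
    refine isProbabilityMeasure_bind_of_measurable ?_ fun ν => ?_
    · exact Measurable.ite (measurableSet_le (by fun_prop) (by fun_prop)) measurable_const
        measurable_const
    · split_ifs
      · refine isProbabilityMeasure_bind_of_measurable ?_ fun ν => ?_
        · exact measurable_drawThreshold (div_pos (mul_pos hc' hΔ) h₁)
        · exact Measure.isProbabilityMeasure_map (by fun_prop)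
      · infer_instance
  · simp only [thresholdStep, hcnt, if_false, if_true]
    have := isProbabilityMeasure_perturb
      (div_pos hΔ (leftBudget_pos h₁ h₂ (not_le.1 hcnt))) h
    exact Measure.isProbabilityMeasure_map (by fun_prop)

theorem thresholdLoop_isMarkov (h₁ : 0 < ε₁) (h₂ : 0 < ε₂) (hΔ : 0 < Δ) (hc : 0 < c) (n : ℕ)
    (D : AggregatedDataset n M) : Measurable (thresholdLoop ε₁ ε₂ T Δ c n D) ∧
      ∀ s, IsProbabilityMeasure (thresholdLoop ε₁ ε₂ T Δ c n D s) := by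
  induction n with
  | zero =>
    simp only [thresholdLoop]
    exact ⟨measurable_const, fun _ => inferInstance⟩
  | succ n ih =>
    obtain ⟨hm, hp⟩ := ih fun i => D i.succ
    have hs := isProbabilityMeasure_thresholdStep (T := T) h₁ h₂ hΔ hc (decide (n = 0)) (D 0)
    have hcons : Measurable fun s' : ThresholdState M =>
        (thresholdLoop ε₁ ε₂ T Δ c n (fun i => D i.succ) s').map
          fun out => (Fin.cons s'.1 out : NoisyDataset (n + 1) M) :=
      measurable_map_param hm ((measurable_cons n).comp (by fun_prop : Measurable
        fun p : ThresholdState M × NoisyDataset n M => (p.1.1, p.2)))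
    simp only [thresholdLoop]
    refine ⟨(Measure.measurable_bind' hcons).comp (measurable_thresholdStep h₁ h₂ hΔ hc _ _),
      fun s => isProbabilityMeasure_bind_of_measurable hcons fun s' => ?_⟩
    exact Measure.isProbabilityMeasure_map (measurable_cons_right _).aemeasurable

end Mechanism

/-! ### Unrolling the loop -/

section Unroll

variable {M : ℕ} {ε₁ ε₂ T Δ : ℝ} {c : ℕ}

/-- The law of the output from a time stamp at which the histogram is perturbed, onwards:
`D 0` is released with fresh noise, a new noisy threshold is drawn, and the loop goes on with the
counter `cnt`. -/
noncomputable def releaseAndContinue (ε₁ ε₂ T Δ : ℝ) (c : ℕ) (n : ℕ)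
    (D : AggregatedDataset (n + 1) M) (cnt : ℕ) : Measure (NoisyDataset (n + 1) M) :=
  (perturb (c * Δ / ε₂) (D 0)).bind fun x =>
    (laplace (c * Δ / ε₁)).bind fun ρ =>
      (thresholdLoop ε₁ ε₂ T Δ c n (fun i => D i.succ) (x, cnt, T + ρ)).map
        fun out => (Fin.cons x out : NoisyDataset (n + 1) M)

theorem measurable_loopCons (h₁ : 0 < ε₁) (h₂ : 0 < ε₂) (hΔ : 0 < Δ) (hc : 0 < c) (n : ℕ)
    (D : AggregatedDataset n M) : Measurable fun s : ThresholdState M =>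
      (thresholdLoop ε₁ ε₂ T Δ c n D s).map
        fun out => (Fin.cons s.1 out : NoisyDataset (n + 1) M) := by
  obtain ⟨hm, hp⟩ := thresholdLoop_isMarkov (T := T) h₁ h₂ hΔ hc n D
  exact measurable_map_param hm ((measurable_cons n).comp (by fun_prop : Measurable
    fun p : ThresholdState M × NoisyDataset n M => (p.1.1, p.2)))

theorem measurable_continue (h₁ : 0 < ε₁) (h₂ : 0 < ε₂) (hΔ : 0 < Δ) (hc : 0 < c) (n : ℕ)
    (D : AggregatedDataset n M) (cnt : ℕ) : Measurable fun x : Fin M → ℝ =>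
      (laplace (c * Δ / ε₁)).bind fun ρ =>
        (thresholdLoop ε₁ ε₂ T Δ c n D (x, cnt, T + ρ)).map
          fun out => (Fin.cons x out : NoisyDataset (n + 1) M) := by
  have hc' : (0 : ℝ) < c := by exact_mod_cast hc
  have hl := isProbabilityMeasure_laplace (b := c * Δ / ε₁) (by positivity)
  refine measurable_bind_param (κ := fun _ => laplace (c * Δ / ε₁)) measurable_const ?_
  exact (measurable_loopCons h₁ h₂ hΔ hc n D).comp (by fun_prop : Measurable
    fun p : (Fin M → ℝ) × ℝ => ((p.1, cnt, T + p.2) : ThresholdState M))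

theorem isProbabilityMeasure_releaseAndContinue (h₁ : 0 < ε₁) (h₂ : 0 < ε₂) (hΔ : 0 < Δ)
    (hc : 0 < c) (n : ℕ) (D : AggregatedDataset (n + 1) M) (cnt : ℕ) :
    IsProbabilityMeasure (releaseAndContinue ε₁ ε₂ T Δ c n D cnt) := by
  have hc' : (0 : ℝ) < c := by exact_mod_cast hc
  have hl := isProbabilityMeasure_laplace (b := c * Δ / ε₁) (by positivity)
  have hp := isProbabilityMeasure_perturb (b := c * Δ / ε₂) (by positivity) (D 0)
  refine isProbabilityMeasure_bind_of_measurable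
    (measurable_continue h₁ h₂ hΔ hc n _ cnt) fun x => ?_
  refine isProbabilityMeasure_bind_of_measurable
    ((measurable_loopCons h₁ h₂ hΔ hc n _).comp (by fun_prop : Measurable
      fun ρ : ℝ => ((x, cnt, T + ρ) : ThresholdState M))) fun ρ => ?_
  have := (thresholdLoop_isMarkov (T := T) h₁ h₂ hΔ hc n fun i => D i.succ).2 (x, cnt, T + ρ)
  exact Measure.isProbabilityMeasure_map (measurable_cons_right _).aemeasurable

theorem thresholdLoop_of_cutoff (h₁ : 0 < ε₁) (h₂ : 0 < ε₂) (hΔ : 0 < Δ) (hc : 0 < c) (n : ℕ)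
    (D : AggregatedDataset (n + 1) M) (x : Fin M → ℝ) {cnt : ℕ} (hcnt : c ≤ cnt) (thr : ℝ) :
    thresholdLoop ε₁ ε₂ T Δ c (n + 1) D (x, cnt, thr) =
      (thresholdLoop ε₁ ε₂ T Δ c n (fun i => D i.succ) (x, cnt, thr)).map
        fun out => (Fin.cons x out : NoisyDataset (n + 1) M) := by
  simp only [thresholdLoop, thresholdStep, hcnt, if_true]
  rw [Measure.dirac_bind (measurable_loopCons h₁ h₂ hΔ hc n _)]

theorem thresholdLoop_last (h₁ : 0 < ε₁) (h₂ : 0 < ε₂) (hΔ : 0 < Δ)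
    (D : AggregatedDataset 1 M) (x : Fin M → ℝ) {cnt : ℕ} (hcnt : cnt < c) (thr : ℝ) :
    thresholdLoop ε₁ ε₂ T Δ c 1 D (x, cnt, thr) =
      (perturb (Δ / leftBudget ε₁ ε₂ c cnt) (D 0)).bind fun y =>
        (Measure.dirac Fin.elim0).map
          fun out => (Fin.cons y out : NoisyDataset 1 M) := by
  rw [thresholdLoop]
  simp only [thresholdStep, not_le.2 hcnt, if_false, decide_true, if_true]
  rw [bind_map_eq_bind (by fun_prop) (measurable_loopCons h₁ h₂ hΔ (by omega) 0 _)]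
  rfl

theorem thresholdLoop_test (h₁ : 0 < ε₁) (h₂ : 0 < ε₂) (hΔ : 0 < Δ) (n : ℕ)
    (D : AggregatedDataset (n + 2) M) (x : Fin M → ℝ) {cnt : ℕ} (hcnt : cnt < c) (thr : ℝ) :
    thresholdLoop ε₁ ε₂ T Δ c (n + 2) D (x, cnt, thr) =
      (laplace (2 * c * Δ / ε₁)).bind fun ν =>
        if thr ≤ histDist x (D 0) + ν then releaseAndContinue ε₁ ε₂ T Δ c (n + 1) D (cnt + 1)
        else (thresholdLoop ε₁ ε₂ T Δ c (n + 1) (fun i => D i.succ) (x, cnt, thr)).map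
          fun out => (Fin.cons x out : NoisyDataset (n + 2) M) := by
  have hc : 0 < c := by omega
  have hc' : (0 : ℝ) < c := by exact_mod_cast hc
  have hm := measurable_loopCons (T := T) h₁ h₂ hΔ hc (n + 1) fun i => D i.succ
  have hd : Measurable fun y : Fin M → ℝ => (laplace (c * Δ / ε₁)).map fun ρ =>
      ((y, cnt + 1, T + ρ) : ThresholdState M) := measurable_drawThreshold (by positivity)
  rw [thresholdLoop]
  simp only [thresholdStep, not_le.2 hcnt, if_false, decide_eq_true_eq, Nat.add_eq_zero_iff,
    one_ne_zero, and_false]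
  rw [Measure.bind_bind (Measurable.ite (measurableSet_le (by fun_prop) (by fun_prop))
    measurable_const measurable_const).aemeasurable hm.aemeasurable]
  congr 1
  funext ν
  split_ifs
  · rw [Measure.bind_bind hd.aemeasurable hm.aemeasurable, releaseAndContinue]
    congr 1
    funext y
    rw [bind_map_eq_bind (by fun_prop) hm]
  · rw [Measure.dirac_bind hm]

end Unroll

/-! ### Privacy loss of the loop -/

section Privacy

variable {M : ℕ} {ε₁ ε₂ T Δ : ℝ} {c : ℕ}

/-- A bound for the privacy loss of one phase of the mechanism: a test exceeding the threshold, the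
release which it triggers, and the draw of the next threshold. For histograms at `L₁` distance at
most one, the summands pay for a shift of the new threshold by one, a shift of the noise of the
test by two, and the perturbed histogram. -/
noncomputable def phaseLoss (ε₁ ε₂ Δ : ℝ) (c : ℕ) : ℝ :=
  1 / (c * Δ / ε₁) + 2 / (2 * c * Δ / ε₁) + 1 / (c * Δ / ε₂)

theorem phaseLoss_eq : phaseLoss ε₁ ε₂ Δ c = (2 * ε₁ + ε₂) / (c * Δ) := by
  unfold phaseLoss
  rw [one_div_div, one_div_div, div_div_eq_mul_div, mul_assoc, mul_div_mul_left _ _ two_ne_zero]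
  ring

theorem phaseLoss_nonneg (h₁ : 0 < ε₁) (h₂ : 0 < ε₂) (hΔ : 0 < Δ) :
    0 ≤ phaseLoss ε₁ ε₂ Δ c := by
  rw [phaseLoss_eq]
  positivity

/-- From the cutoff on, the output depends neither on the dataset nor on the threshold. -/
theorem thresholdLoop_cutoff_eq (h₁ : 0 < ε₁) (h₂ : 0 < ε₂) (hΔ : 0 < Δ) (hc : 0 < c) (n : ℕ)
    (D D' : AggregatedDataset n M) (x : Fin M → ℝ) {cnt : ℕ} (hcnt : c ≤ cnt) (thr thr' : ℝ) :
    thresholdLoop ε₁ ε₂ T Δ c n D (x, cnt, thr) =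
      thresholdLoop ε₁ ε₂ T Δ c n D' (x, cnt, thr') := by
  induction n with
  | zero => rfl
  | succ n ih =>
    rw [thresholdLoop_of_cutoff h₁ h₂ hΔ hc n D x hcnt,
      thresholdLoop_of_cutoff h₁ h₂ hΔ hc n D' x hcnt, ih]

/-- If the loop loses at most `κ` when the threshold is raised by one together with the change of
the dataset, then drawing the threshold costs `1 / (c Δ / ε₁)` on top of this. -/
theorem releaseAndContinue_expLE (h₁ : 0 < ε₁) (h₂ : 0 < ε₂) (hΔ : 0 < Δ) (hc : 0 < c) (n : ℕ)
    {D D' : AggregatedDataset (n + 1) M} (hD : ∑ m, |(D 0 m : ℝ) - D' 0 m| ≤ 1) (cnt : ℕ) {κ : ℝ}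
    (hloop : ∀ x thr, ExpLE κ
      (thresholdLoop ε₁ ε₂ T Δ c n (fun i => D i.succ) (x, cnt, thr))
      (thresholdLoop ε₁ ε₂ T Δ c n (fun i => D' i.succ) (x, cnt, thr + 1))) :
    ExpLE (1 / (c * Δ / ε₂) + (1 / (c * Δ / ε₁) + κ))
      (releaseAndContinue ε₁ ε₂ T Δ c n D cnt) (releaseAndContinue ε₁ ε₂ T Δ c n D' cnt) := by
  have hc' : (0 : ℝ) < c := by exact_mod_cast hc
  refine (perturb_expLE (by positivity) hD).bind (measurable_continue h₁ h₂ hΔ hc n _ cnt)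
    (measurable_continue h₁ h₂ hΔ hc n _ cnt) fun x => ?_
  have hs : Measurable fun ρ : ℝ => ((x, cnt, T + ρ) : ThresholdState M) := by fun_prop
  have h := laplace_bind_shift (b := c * Δ / ε₁) (by positivity) 1
    ((measurable_loopCons (T := T) h₁ h₂ hΔ hc n fun i => D i.succ).comp hs)
    ((measurable_loopCons (T := T) h₁ h₂ hΔ hc n fun i => D' i.succ).comp hs) (κ := κ) fun ρ => by
      simpa only [Function.comp_apply, add_assoc] using
        (hloop x (T + ρ)).map (measurable_cons_right x)
  rwa [abs_one] at h

/-- The loss of the last release, on which all of the budget left is spent, does not exceed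
the loss allowed for the phases that have not taken place. -/
theorem last_loss_le (h₁ : 0 < ε₁) (hΔ : 0 < Δ) {cnt : ℕ} (hcnt : cnt < c) :
    1 / (Δ / leftBudget ε₁ ε₂ c cnt) ≤ (c - cnt : ℕ) * phaseLoss ε₁ ε₂ Δ c := by
  have hc : 0 < c := by omega
  have hc' : (0 : ℝ) < c := by exact_mod_cast hc
  rw [one_div_div, leftBudget_eq hc, phaseLoss_eq, Nat.cast_sub hcnt.le, mul_div_assoc, div_div]
  have : (0 : ℝ) ≤ (c : ℝ) - cnt := sub_nonneg.2 (by exact_mod_cast hcnt.le)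
  gcongr
  linarith

/-- The sparse vector argument. Raising the threshold by one makes up for the change of the
distances, so that tests below the threshold are free of charge; a test above the threshold is
paid for by shifting its noise by two, and it ends the phase. -/
theorem thresholdLoop_expLE (h₁ : 0 < ε₁) (h₂ : 0 < ε₂) (hΔ : 0 < Δ) (hc : 0 < c) (n : ℕ)
    {D D' : AggregatedDataset n M} (hD : ∀ i, ∑ m, |(D i m : ℝ) - D' i m| ≤ 1)
    (x : Fin M → ℝ) (cnt : ℕ) (thr : ℝ) :
    ExpLE ((c - cnt : ℕ) * phaseLoss ε₁ ε₂ Δ c)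
      (thresholdLoop ε₁ ε₂ T Δ c n D (x, cnt, thr))
      (thresholdLoop ε₁ ε₂ T Δ c n D' (x, cnt, thr + 1)) := by
  have hc' : (0 : ℝ) < c := by exact_mod_cast hc
  have hpl := phaseLoss_nonneg (c := c) h₁ h₂ hΔ
  induction n generalizing x cnt thr with
  | zero => exact (ExpLE.of_eq rfl).mono (by positivity)
  | succ n ih =>
    have hD0 := hD 0
    have ih := ih fun i => hD i.succ
    rcases le_or_gt c cnt with hcnt | hcnt
    · exact (ExpLE.of_eq (thresholdLoop_cutoff_eq h₁ h₂ hΔ hc _ D D' x hcnt _ _)).mono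
        (by positivity)
    cases n with
    | zero =>
      have hlb := div_pos hΔ (leftBudget_pos h₁ h₂ hcnt)
      have hm : Measurable fun y : Fin M → ℝ => (Measure.dirac Fin.elim0).map
          fun out => (Fin.cons y out : NoisyDataset 1 M) :=
        measurable_map_param (κ := fun _ => Measure.dirac Fin.elim0) measurable_const
          (measurable_cons 0)
      rw [thresholdLoop_last h₁ h₂ hΔ D x hcnt, thresholdLoop_last h₁ h₂ hΔ D' x hcnt]
      refine ((perturb_expLE hlb hD0).bind hm hm fun y => ExpLE.of_eq rfl).mono ?_
      rw [add_zero]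
      exact last_loss_le h₁ hΔ hcnt
    | succ n =>
      rw [thresholdLoop_test h₁ h₂ hΔ n D x hcnt, thresholdLoop_test h₁ h₂ hΔ n D' x hcnt]
      have hb : (0 : ℝ) < 2 * c * Δ / ε₁ := by positivity
      have hset : ∀ t d : ℝ, MeasurableSet {ν : ℝ | t ≤ d + ν} := fun t d =>
        measurableSet_le (by fun_prop) (by fun_prop)
      have hd : histDist x (D 0) ≤ histDist x (D' 0) + 1 := histDist_le x hD0
      have hd' : histDist x (D' 0) ≤ histDist x (D 0) + 1 :=
        histDist_le x (by simpa only [abs_sub_comm] using hD0)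
      intro O hO
      rw [bind_ite_apply _ (hset _ _) _ _ hO, bind_ite_apply _ (hset _ _) _ _ hO, mul_add]
      refine add_le_add ?_ ?_
      · have hp := laplace_apply_shift hb 2 (p := fun ν => thr ≤ histDist x (D 0) + ν)
          (q := fun ν => thr + 1 ≤ histDist x (D' 0) + ν) (hset _ _) fun ν hν => by linarith
        have hr := releaseAndContinue_expLE h₁ h₂ hΔ hc (n + 1) hD0 (cnt + 1)
          fun x thr => ih x (cnt + 1) thr
        refine (mul_le_mul' hp (hr O hO)).trans_eq ?_
        have hk : ((c - cnt : ℕ) : ℝ) = (c - (cnt + 1) : ℕ) + 1 := by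
          exact_mod_cast (by omega : c - cnt = c - (cnt + 1) + 1)
        rw [mul_mul_mul_comm, ← ENNReal.ofReal_mul (Real.exp_nonneg _), ← Real.exp_add, hk,
          abs_two]
        congr 3
        rw [add_one_mul]
        nth_rewrite 3 [phaseLoss]
        ring
      · have hp : laplace (2 * c * Δ / ε₁) {ν | ¬ thr ≤ histDist x (D 0) + ν} ≤
            laplace (2 * c * Δ / ε₁) {ν | ¬ thr + 1 ≤ histDist x (D' 0) + ν} :=
          measure_mono fun ν (hν : ¬ _ ≤ _) => by
            change ¬ _ ≤ _
            linarith
        have hr := (ih x cnt thr).map (measurable_cons_right x) O hO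
        refine (mul_le_mul' hp hr).trans_eq ?_
        ring

end Privacy

/-! ### Differential privacy of the mechanism -/

/-- Neighboring datasets differ by one user at one base station at every time stamp. -/
theorem Neighboring.sum_abs_sub_le {S M : ℕ} {D D' : AggregatedDataset S M}
    (h : Neighboring D D') (i : Fin S) : ∑ m, |(D i m : ℝ) - D' i m| ≤ 1 := by
  have key : ∀ (U : Multiset (Trajectory S M)) (l : Trajectory S M),
      ∑ m, |(aggregate (l ::ₘ U) i m : ℝ) - aggregate U i m| ≤ 1 := by
    intro U l
    refine le_of_eq ?_
    have : ∀ m, |(aggregate (l ::ₘ U) i m : ℝ) - aggregate U i m| = if l i = m then 1 else 0 := by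
      intro m
      rw [aggregate, aggregate, Multiset.countP_cons]
      split_ifs <;> simp
    simp [this]
  obtain ⟨U, l, ⟨rfl, rfl⟩ | ⟨rfl, rfl⟩⟩ := h
  · exact key U l
  · simpa only [abs_sub_comm] using key U l

theorem mainTheorem2 (S M : ℕ) (ε α T Δ : ℝ) (c : ℕ) (hε : 0 < ε) (hα₀ : 0 < α) (hα₁ : α < 1)
    (hc : 1 ≤ c) (hΔ : 2 ≤ Δ) :
    IsDifferentiallyPrivate (Neighboring (S := S) (M := M))
      (thresholdPerturbation (M := M) ε α T Δ c S) ε := by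
  have h₁ : 0 < α * ε := mul_pos hα₀ hε
  have h₂ : 0 < (1 - α) * ε := mul_pos (sub_pos.2 hα₁) hε
  have hΔ' : 0 < Δ := by linarith
  have hc' : (0 : ℝ) < c := by exact_mod_cast hc
  cases S with
  | zero =>
    refine ⟨fun D => ?_, fun D D' _ => ?_⟩
    · rw [thresholdPerturbation]
      infer_instance
    · exact (ExpLE.of_eq rfl).mono hε.le
  | succ n =>
    refine ⟨fun D => isProbabilityMeasure_releaseAndContinue h₁ h₂ hΔ' hc n D 1,
      fun D D' hDD => ?_⟩
    have hD := hDD.sum_abs_sub_le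
    refine (releaseAndContinue_expLE (T := T) h₁ h₂ hΔ' hc n (hD 0) 1 fun x thr =>
      thresholdLoop_expLE h₁ h₂ hΔ' hc n (fun i => hD i.succ) x 1 thr).mono ?_
    -- `Δ ≥ 2` absorbs the two shifts paid for with `ε₁`
    have hphase : c * phaseLoss (α * ε) ((1 - α) * ε) Δ c ≤ ε := by
      rw [phaseLoss_eq, mul_div_assoc', mul_div_mul_left _ _ hc'.ne', div_le_iff₀ hΔ']
      nlinarith
    -- the first release and the first threshold make a phase without a test
    have hfirst : 1 / (c * Δ / ((1 - α) * ε)) + 1 / (c * Δ / (α * ε)) ≤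
        phaseLoss (α * ε) ((1 - α) * ε) Δ c := by
      have : 0 ≤ 2 / (2 * c * Δ / (α * ε)) := by positivity
      unfold phaseLoss
      linarith
    rw [Nat.cast_sub hc, Nat.cast_one]
    linarith
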